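/- **Theorem 3.3.** Let $R$ be a commutative Noetherian local ring with maximal ideal $\mathfrak m$; all modules are finitely generated. For an ideal $\mathfrak a$ and a module $M$, let $\operatorname{depth}_R(\mathfrak a,M)$ be the common length of the maximal $M$-regular sequences in $\mathfrak a$ if $\mathfrak aM\neq M$, and $\infty$ if $\mathfrak aM=M$; put $\operatorname{depth}R_{\mathfrak p}=\operatorname{depth}_{R_{\mathfrak p}}(\mathfrak pR_{\mathfrak p},R_{\mathfrak p})$. Let $\Omega^n_RN$ denote the $n$th syzygy of $N$ in a minimal free resolution (with $\Omega^0_RN=N$), and let $\operatorname{Tr}X$ be the cokernel of $\operatorname{Hom}_R(f,R)$, where $F_1\xrightarrow{f}F_0\to X\to0$ is the beginning of a minimal free resolution of $X$. A module is an *$r$th syzygy module* if it is stably isomorphic (isomorphic after adding finitely generated free summands to both sides) to $\Omega^r_RY$ for some module $Y$. For $s\geq1$, a module $N$ is *$s$-Tor-rigid* if, whenever $X$ is a module and $t\geq0$ is an integer with $\operatorname{Tor}^R_i(N,X)=0$ for $i=t+1,\dots,t+s$, one has $\operatorname{Tor}^R_i(N,X)=0$ for all $i\geq t+1$. Let $N$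 be an $R$-module, $\mathfrak a$ an ideal of $R$, and $n\geq0$ an integer. Set $M=\Omega^n_RN$ and $m=\operatorname{depth}_R(\mathfrak a,R)$. Assume: (i) $M\neq0$ and $m\geq n$; (ii) $N$ is $(n+1)$-Tor-rigid. If $n\geq1$, assume further: (iii) $N_{\mathfrak p}$ is a free $R_{\mathfrak p}$-module for every prime ideal $\mathfrak p$ of $R$ with $\operatorname{depth}R_{\mathfrak p}\leq n-1$; (iv) if $m<\infty$ (that is, if $\mathfrak a\neq R$), then $\operatorname{Tr}\Omega^m_R(R/\mathfrak a)$ is an $(n-1)$st syzygy module. Then $\operatorname{depth}_R(\mathfrak a,M)\leq m+n$. -/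

import Mathlib

open CategoryTheory

universe u

namespace DepthIneq

noncomputable section

/-- The `a`-depth of `M`: it is `∞` if `a M = M`, and otherwise the largest length of an
`M`-regular sequence in `a` (over a Noetherian ring, for `M` finitely generated with `a M ≠ M`,
all maximal `M`-regular sequences in `a` have this length). -/
def depth {R : Type*} [CommRing R] (a : Ideal R) (M : Type*) [AddCommGroup M] [Module R M] : ℕ∞ :=
  open Classical in
  if a • (⊤ : Submodule R M) = ⊤ then ⊤
  else ⨆ rs ∈ {rs : List R | (∀ x ∈ rs, x ∈ a) ∧ RingTheory.Sequence.IsRegular M rs},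
    (rs.length : ℕ∞)

/-- The set of all prime ideals `p` of `R` such that `depth R_p ≤ k`. -/
def depthLocus (R : Type*) [CommRing R] (k : ℕ) : Set (PrimeSpectrum R) :=
  {p | depth (IsLocalRing.maximalIdeal (Localization.AtPrime p.asIdeal))
    (Localization.AtPrime p.asIdeal) ≤ k}

/-- `N` is locally free on the set `S` of primes. -/
def IsLocallyFreeOn {R : Type*} [CommRing R] (N : Type*) [AddCommGroup N] [Module R N]
    (S : Set (PrimeSpectrum R)) : Prop :=
  ∀ p ∈ S, Module.Free (Localization.AtPrime p.asIdeal)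
    (LocalizedModule p.asIdeal.primeCompl N)

/-- `N` is `s`-Tor-rigid (among finitely generated modules): whenever `s` consecutive modules
`Tor_i(N, X)`, `i = t + 1, …, t + s`, vanish, all `Tor_i(N, X)` with `i ≥ t + 1` vanish. -/
def IsTorRigid (R : Type u) [CommRing R] (s : ℕ) (N : Type u) [AddCommGroup N] [Module R N] :
    Prop :=
  ∀ (X : ModuleCat.{u} R) [Module.Finite R X] (t : ℕ),
    (∀ i : ℕ, t + 1 ≤ i → i ≤ t + s →
      Limits.IsZero (((Tor (ModuleCat.{u} R) i).obj (ModuleCat.of R N)).obj X)) →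
    ∀ i : ℕ, t + 1 ≤ i →
      Limits.IsZero (((Tor (ModuleCat.{u} R) i).obj (ModuleCat.of R N)).obj X)

section Local

variable (R : Type u) [CommRing R] [IsLocalRing R]

/-- `K ≅ Ω N`: `K` is isomorphic to the kernel of a minimal free cover `π : R ^ b → N`, where
minimality means that the kernel lies in `𝔪 R ^ b`. -/
def IsFirstSyzygy (N : Type u) [AddCommGroup N] [Module R N]
    (K : Type u) [AddCommGroup K] [Module R K] : Prop :=
  ∃ (b : ℕ) (π : (Fin b → R) →ₗ[R] N), Function.Surjective π ∧
    LinearMap.ker π ≤ IsLocalRing.maximalIdeal R • (⊤ : Submodule R (Fin b → R)) ∧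
    Nonempty (K ≃ₗ[R] LinearMap.ker π)

/-- `M ≅ Ωⁿ N`: the module `M` is isomorphic to the `n`-th syzygy of `N` in a minimal free
resolution of `N`; the resolution is spliced from the successive minimal free covers. -/
def IsSyzygy : ℕ → (N : Type u) → [AddCommGroup N] → [Module R N] →
    (M : Type u) → [AddCommGroup M] → [Module R M] → Prop
  | 0, N, _, _, M, _, _ => Nonempty (M ≃ₗ[R] N)
  | n + 1, N, _, _, M, _, _ =>
    ∃ K : ModuleCat.{u} R, IsFirstSyzygy R N K ∧ IsSyzygy n K M

/-- `T ≅ Tr X`: the module `T` is isomorphic to the cokernel of the `R`-dual of `f`, for a minimal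
free presentation `F₁ --f→ F₀ --g→ X → 0` (the first step of a minimal free resolution). -/
def IsTranspose (X : Type u) [AddCommGroup X] [Module R X]
    (T : Type u) [AddCommGroup T] [Module R T] : Prop :=
  ∃ (p q : ℕ) (f : (Fin p → R) →ₗ[R] (Fin q → R)) (g : (Fin q → R) →ₗ[R] X),
    Function.Surjective g ∧ Function.Exact f g ∧
    LinearMap.range f ≤ IsLocalRing.maximalIdeal R • (⊤ : Submodule R (Fin q → R)) ∧
    LinearMap.ker f ≤ IsLocalRing.maximalIdeal R • (⊤ : Submodule R (Fin p → R)) ∧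
    Nonempty (T ≃ₗ[R] (Module.Dual R (Fin p → R) ⧸ LinearMap.range f.dualMap))

/-- `X` and `Z` are stably isomorphic: `X ⊕ F ≅ Z ⊕ G` with `F`, `G` finite free. -/
def IsStablyIso (X : Type u) [AddCommGroup X] [Module R X]
    (Z : Type u) [AddCommGroup Z] [Module R Z] : Prop :=
  ∃ p q : ℕ, Nonempty ((X × (Fin p → R)) ≃ₗ[R] (Z × (Fin q → R)))

/-- `X` is an `r`-th syzygy module: up to stable isomorphism it is `Ω^r Y` for some finitely
generated module `Y`. Every module is a `0`-th syzygy module. -/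
def IsSyzygyModule (r : ℕ) (X : Type u) [AddCommGroup X] [Module R X] : Prop :=
  ∃ Y Z : ModuleCat.{u} R, Module.Finite R Y ∧ IsSyzygy R r Y Z ∧ IsStablyIso R X Z

end Local

end

end DepthIneq

/-!
The proof turns a large depth of `M = Ωⁿ N` into a vanishing of `Tor(N, T)`, where `T` is the transpose
of `B = Ωᵐ (R ⧸ a)`, and then lets rigidity transfer it to `R`. Let `m` be the `a`-depth of `R`, which
may be assumed finite, and suppose that the `a`-depth of `M` is at least `m + n + 1`. By the theorem of
Rees (`natCast_le_depth_iff`), `Extⁱ(R ⧸ a, M) = 0` for `i ≤ m + n`, and `Extⁱ(R ⧸ a, R) = 0` for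
`i < m` but not for `i = m`.

Let `F` be the minimal free resolution of `R ⧸ a`, so that `T` is the cokernel of `Fₘ* → Fₘ₊₁*`.
* The complex `0 → F₀* ⊗ M → ⋯ → Fₘ₊₁* ⊗ M → T ⊗ M → 0` is exact, as its cohomology is
  `Extⁱ(R ⧸ a, M)` for `i ≤ m`. Counting along it, `T ⊗ M` has grade at least `n`
  (`IsSyzygy.gradeGE_hom`, `GradeGE.tensor_of_hom`).
* For each `L`, `Tor₁(T, L)` is a quotient of `Extᵐ(R ⧸ a, L)`; it is therefore killed by `a`, and it
  is zero for `L = M` (`smul_eq_zero_of_cycles`, `IsSyzygy.exists_embedding_quotient`).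
* The module `T` is an `(n - 1)`st syzygy, so its grade is at least `n - 1`. Starting from
  `Tor₁(T, M) = 0` and the grade of `T ⊗ M`, one descends from `Ωʲ⁺¹ N` to `Ωʲ N`: `Tor₁(T, Ωʲ N)` is a
  submodule killed by `a` of a module of positive grade. This gives `Torᵢ(N, T) = 0` for
  `1 ≤ i ≤ n + 1` (`IsSyzygy.exact_lTensor_of_grade`).
* By rigidity also `Torₙ₊₂(N, T) = Tor₂(M, T) = 0`. Then `W ⊗ M → Fₘ* ⊗ M` is injective for
  `W = ker (Fₘ* → Fₘ₊₁*)`, and `Extᵐ(R ⧸ a, M) = 0` makes `Fₘ₋₁* ⊗ M → W ⊗ M` surjective. So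
  `Extᵐ(R ⧸ a, R) ⊗ M = 0`, and as `R` is local and `M ≠ 0` this forces `Extᵐ(R ⧸ a, R) = 0`
  (`exact_of_exact_rTensor`), a contradiction.

`Tor` is never compared in its two arguments as a functor: it is computed from one resolution of `T`
(`exists_resolution_tor`), and dimension shifting in `N` is done by hand.
-/

namespace DepthIneq

open Abelian

/-! ### Vanishing of Ext along short exact sequences -/

section Ext

variable {R : Type u} [CommRing R]
variable {A B C : Type u} [AddCommGroup A] [Module R A] [AddCommGroup B] [Module R B]
  [AddCommGroup C] [Module R C]

lemma shortExact_of_exact {f : A →ₗ[R] B} {g : B →ₗ[R] C} (hf : Function.Injective f)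
    (hfg : Function.Exact f g) (hg : Function.Surjective g) :
    (ModuleCat.shortComplexOfCompEqZero f g hfg.linearMap_comp_eq_zero).ShortExact :=
  ModuleCat.shortComplex_shortExact _ hfg hf hg

/-- `ExtVanish X i L` says that `Extⁱ(X, L) = 0`. -/
def ExtVanish (X : Type u) [AddCommGroup X] [Module R X] (i : ℕ)
    (L : Type u) [AddCommGroup L] [Module R L] : Prop :=
  Subsingleton (Ext (ModuleCat.of R X) (ModuleCat.of R L) i)

variable (X : Type u) [AddCommGroup X] [Module R X]

lemma ExtVanish.cokernel {f : A →ₗ[R] B} {g : B →ₗ[R] C} (hf : Function.Injective f)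
    (hfg : Function.Exact f g) (hg : Function.Surjective g) {i : ℕ}
    (hB : ExtVanish (R := R) X i B) (hA : ExtVanish (R := R) X (i + 1) A) :
    ExtVanish (R := R) X i C := by
  refine subsingleton_of_forall_eq 0 fun z => ?_
  obtain ⟨w, hw⟩ := Ext.covariant_sequence_exact₃ _ (shortExact_of_exact hf hfg hg) z
    (rfl : i + 1 = i + 1) (hA.elim _ _)
  rw [← hw, hB.elim w 0, Ext.zero_comp]

lemma ExtVanish.middle {f : A →ₗ[R] B} {g : B →ₗ[R] C} (hf : Function.Injective f)
    (hfg : Function.Exact f g) (hg : Function.Surjective g) {i : ℕ}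
    (hA : ExtVanish (R := R) X i A) (hC : ExtVanish (R := R) X i C) :
    ExtVanish (R := R) X i B := by
  refine subsingleton_of_forall_eq 0 fun z => ?_
  obtain ⟨w, hw⟩ := Ext.covariant_sequence_exact₂ _ (shortExact_of_exact hf hfg hg) z
    (hC.elim _ _)
  rw [← hw, hA.elim w 0, Ext.zero_comp]

lemma ExtVanish.kernel_succ {f : A →ₗ[R] B} {g : B →ₗ[R] C} (hf : Function.Injective f)
    (hfg : Function.Exact f g) (hg : Function.Surjective g) {i : ℕ}
    (hC : ExtVanish (R := R) X i C) (hB : ExtVanish (R := R) X (i + 1) B) :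
    ExtVanish (R := R) X (i + 1) A := by
  refine subsingleton_of_forall_eq 0 fun z => ?_
  obtain ⟨w, hw⟩ := Ext.covariant_sequence_exact₁ _ (shortExact_of_exact hf hfg hg) z
    (hB.elim _ _) rfl
  rw [← hw, hC.elim w 0, Ext.zero_comp]

lemma ExtVanish.of_retract {s : A →ₗ[R] B} {r : B →ₗ[R] A} (h : r ∘ₗ s = LinearMap.id) {i : ℕ}
    (hB : ExtVanish (R := R) X i B) : ExtVanish (R := R) X i A := by
  refine subsingleton_of_forall_eq 0 fun z => ?_
  have h1 : ModuleCat.ofHom s ≫ ModuleCat.ofHom r = 𝟙 (ModuleCat.of R A) := by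
    rw [← ModuleCat.ofHom_comp, h]; rfl
  have h2 : (z.comp (Ext.mk₀ (ModuleCat.ofHom s)) (add_zero i)).comp
      (Ext.mk₀ (ModuleCat.ofHom r)) (add_zero i) = z := by
    rw [Ext.comp_assoc_of_third_deg_zero, Ext.mk₀_comp_mk₀, h1, Ext.comp_mk₀_id]
  rw [← h2, hB.elim (z.comp (Ext.mk₀ (ModuleCat.ofHom s)) (add_zero i)) 0, Ext.zero_comp]

variable {X}

lemma extVanish_zero_iff {L : Type u} [AddCommGroup L] [Module R L] :
    ExtVanish (R := R) X 0 L ↔ ∀ φ : X →ₗ[R] L, φ = 0 := by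
  have e : Ext (ModuleCat.of R X) (ModuleCat.of R L) 0 ≃ (X →ₗ[R] L) :=
    (Ext.addEquiv₀.trans ModuleCat.homAddEquiv).toEquiv
  constructor
  · intro h φ
    have : Subsingleton (X →ₗ[R] L) := e.subsingleton_congr.mp h
    exact Subsingleton.elim _ _
  · intro h
    have : Subsingleton (X →ₗ[R] L) := ⟨fun a b => (h a).trans (h b).symm⟩
    exact e.subsingleton_congr.mpr this

/-- Dimension shift: for a short exact sequence `0 → A → B → C → 0` with `B` projective,
`Extⁱ⁺²(C, L) = 0` if and only if `Extⁱ⁺¹(A, L) = 0`. -/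
lemma extVanish_shift [Module.Projective R B] {f : A →ₗ[R] B} {g : B →ₗ[R] C}
    (hf : Function.Injective f) (hfg : Function.Exact f g) (hg : Function.Surjective g) {i : ℕ}
    {L : Type u} [AddCommGroup L] [Module R L] :
    ExtVanish (R := R) C (i + 2) L ↔ ExtVanish (R := R) A (i + 1) L := by
  have : Projective (ModuleCat.of R B) := inferInstance
  constructor
  · intro h
    refine subsingleton_of_forall_eq 0 fun z => ?_
    obtain ⟨w, hw⟩ := Ext.contravariant_sequence_exact₁ (shortExact_of_exact hf hfg hg)
      (ModuleCat.of R L) z (show 1 + (i + 1) = i + 2 by omega) (h.elim _ _)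
    rw [← hw, Ext.eq_zero_of_projective (P := ModuleCat.of R B) w, Ext.comp_zero]
  · intro h
    refine subsingleton_of_forall_eq 0 fun z => ?_
    obtain ⟨w, hw⟩ := Ext.contravariant_sequence_exact₃ (shortExact_of_exact hf hfg hg)
      (ModuleCat.of R L) z (Ext.eq_zero_of_projective (P := ModuleCat.of R B) _)
      (show 1 + (i + 1) = i + 2 by omega)
    rw [← hw, h.elim w 0, Ext.comp_zero]

/-- For a short exact sequence `0 → A → B → C → 0` with `B` projective, `Ext¹(C, L) = 0` if and
only if every homomorphism `A → L` extends to `B`. -/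
lemma extVanish_one_iff [Module.Projective R B] {f : A →ₗ[R] B} {g : B →ₗ[R] C}
    (hf : Function.Injective f) (hfg : Function.Exact f g) (hg : Function.Surjective g)
    {L : Type u} [AddCommGroup L] [Module R L] :
    ExtVanish (R := R) C 1 L ↔ ∀ φ : A →ₗ[R] L, ∃ ψ : B →ₗ[R] L, φ = ψ ∘ₗ f := by
  have : Projective (ModuleCat.of R B) := inferInstance
  let S := ModuleCat.shortComplexOfCompEqZero f g hfg.linearMap_comp_eq_zero
  have hS : S.ShortExact := shortExact_of_exact hf hfg hg
  constructor
  · intro h φ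
    obtain ⟨w, hw⟩ := Ext.contravariant_sequence_exact₁ hS (ModuleCat.of R L)
      (Ext.mk₀ (ModuleCat.ofHom φ)) (show 1 + 0 = 1 by omega) (h.elim _ _)
    obtain ⟨ψ, rfl⟩ := Ext.addEquiv₀.symm.surjective w
    refine ⟨ψ.hom, ?_⟩
    simp only [Ext.addEquiv₀_symm_apply, Ext.mk₀_comp_mk₀] at hw
    have hw' := (Ext.mk₀_bijective _ _).1 hw
    exact (congrArg ModuleCat.Hom.hom hw').symm
  · intro h
    refine subsingleton_of_forall_eq 0 fun z => ?_
    obtain ⟨w, hw⟩ := Ext.contravariant_sequence_exact₃ hS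
      (ModuleCat.of R L) z (Ext.eq_zero_of_projective (P := ModuleCat.of R B) _)
      (show 1 + 0 = 1 by omega)
    obtain ⟨φ, rfl⟩ := Ext.addEquiv₀.symm.surjective w
    obtain ⟨ψ, hψ⟩ := h φ.hom
    have hφ : φ = S.f ≫ ModuleCat.ofHom ψ := by
      ext1; exact hψ
    rw [← hw, hφ, Ext.addEquiv₀_symm_apply, ← Ext.mk₀_comp_mk₀,
      hS.extClass_comp_assoc]

end Ext

/-! ### The grade of an ideal on a module -/

section Grade

variable {R : Type u} [CommRing R] (a : Ideal R)

/-- `GradeGE a k L` says that `Extⁱ(R ⧸ a, L) = 0` for all `i < k`. For `L` finitely generated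
over a Noetherian ring with `a L ≠ L` this means that the `a`-depth of `L` is at least `k`; the
formulation by `Ext` is the one that passes along exact sequences. -/
def GradeGE (k : ℕ) (L : Type u) [AddCommGroup L] [Module R L] : Prop :=
  ∀ i < k, ExtVanish (R := R) (R ⧸ a) i L

variable {a}
variable {A B C : Type u} [AddCommGroup A] [Module R A] [AddCommGroup B] [Module R B]
  [AddCommGroup C] [Module R C]

lemma GradeGE.mono {k l : ℕ} (hkl : k ≤ l) (h : GradeGE a l A) : GradeGE a k A :=
  fun i hi => h i (hi.trans_le hkl)

lemma GradeGE.cokernel {f : A →ₗ[R] B} {g : B →ₗ[R] C} (hf : Function.Injective f)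
    (hfg : Function.Exact f g) (hg : Function.Surjective g) {k : ℕ}
    (hA : GradeGE a (k + 1) A) (hB : GradeGE a k B) : GradeGE a k C :=
  fun i hi => ExtVanish.cokernel _ hf hfg hg (hB i hi) (hA (i + 1) (by omega))

lemma GradeGE.middle {f : A →ₗ[R] B} {g : B →ₗ[R] C} (hf : Function.Injective f)
    (hfg : Function.Exact f g) (hg : Function.Surjective g) {k : ℕ}
    (hA : GradeGE a k A) (hC : GradeGE a k C) : GradeGE a k B :=
  fun i hi => ExtVanish.middle _ hf hfg hg (hA i hi) (hC i hi)

lemma GradeGE.of_retract {s : A →ₗ[R] B} {r : B →ₗ[R] A} (h : r ∘ₗ s = LinearMap.id) {k : ℕ}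
    (hB : GradeGE a k B) : GradeGE a k A :=
  fun i hi => ExtVanish.of_retract _ h (hB i hi)

lemma GradeGE.congr (e : A ≃ₗ[R] B) {k : ℕ} (hA : GradeGE a k A) : GradeGE a k B :=
  hA.of_retract (s := e.symm.toLinearMap) (r := e.toLinearMap) (by ext; simp)

/-- A module of positive grade has no nonzero element killed by `a`. -/
lemma GradeGE.eq_zero {k : ℕ} (hk : 0 < k) (hA : GradeGE a k A) {z : A}
    (hz : ∀ x ∈ a, x • z = 0) : z = 0 := by
  have h := extVanish_zero_iff.mp (hA 0 hk)
    (a.liftQ (LinearMap.toSpanSingleton R A z) (fun x hx => by simpa using hz x hx))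
  have h1 := LinearMap.congr_fun h (Submodule.Quotient.mk 1)
  rw [Submodule.liftQ_apply] at h1
  simpa using h1

lemma GradeGE.of_eq_zero (h : ∀ z : A, z = 0) (k : ℕ) : GradeGE a k A := by
  intro i _
  have : Subsingleton A := ⟨fun x y => (h x).trans (h y).symm⟩
  have h0 : Limits.IsZero (ModuleCat.of R A) := ModuleCat.isZero_of_subsingleton _
  refine ⟨fun x y => ?_⟩
  rw [← Ext.comp_mk₀_id x, ← Ext.comp_mk₀_id y, h0.eq_zero_of_src (𝟙 _)]
  simp

lemma GradeGE.kernel {f : A →ₗ[R] B} {g : B →ₗ[R] C} (hf : Function.Injective f)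
    (hfg : Function.Exact f g) (hg : Function.Surjective g) {k : ℕ}
    (hC : GradeGE a k C) (hB : GradeGE a (k + 1) B) : GradeGE a (k + 1) A := by
  rintro (_ | i) hi
  · refine extVanish_zero_iff.mpr fun φ => ?_
    have := extVanish_zero_iff.mp (hB 0 hi) (f ∘ₗ φ)
    ext
    apply hf
    simpa using LinearMap.congr_fun this (Submodule.Quotient.mk 1)
  · exact ExtVanish.kernel_succ _ hf hfg hg (hC i (by omega)) (hB _ hi)

lemma GradeGE.pi {k : ℕ} (hA : GradeGE a k A) (b : ℕ) : GradeGE a k (Fin b → A) := by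
  induction b with
  | zero => exact GradeGE.of_eq_zero (fun z => Subsingleton.elim _ _) k
  | succ b ih =>
    refine GradeGE.congr (Fin.consLinearEquiv R (fun _ : Fin (b + 1) => A)) ?_
    exact GradeGE.middle (f := LinearMap.inl R A (Fin b → A)) (g := LinearMap.snd R A (Fin b → A))
      LinearMap.inl_injective (by
        intro x; constructor
        · intro h; exact ⟨x.1, Prod.ext rfl h.symm⟩
        · rintro ⟨y, rfl⟩; rfl) LinearMap.snd_surjective hA ih

lemma GradeGE.hom_free {k : ℕ} {L : Type u} [AddCommGroup L] [Module R L] (h : GradeGE a k L)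
    (b : ℕ) : GradeGE a k ((Fin b → R) →ₗ[R] L) :=
  (h.pi b).congr ((Pi.basisFun R (Fin b)).constr R)

lemma GradeGE.tensor_free {k : ℕ} {L : Type u} [AddCommGroup L] [Module R L]
    (h : GradeGE a k L) (b : ℕ) : GradeGE a k (TensorProduct R L (Fin b → R)) :=
  (h.pi b).congr (TensorProduct.piScalarRight R R L (Fin b)).symm

end Grade

/-! ### Grade and depth -/

section Rees

lemma support_quotient {R : Type u} [CommRing R] {a : Ideal R} :
    Module.support R (R ⧸ a) = PrimeSpectrum.zeroLocus a := by
  rw [Module.support_eq_zeroLocus, Ideal.annihilator_quotient]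

variable {R : Type u} [CommRing R] [IsLocalRing R] {a : Ideal R}
  {L : Type u} [AddCommGroup L] [Module R L] [Module.Finite R L] [Nontrivial L]

lemma smul_top_ne_top (ha : a ≠ ⊤) : a • (⊤ : Submodule R L) ≠ ⊤ := by
  intro h
  have h2 : (⊤ : Submodule R L) = ⊥ := Submodule.eq_bot_of_le_smul_of_le_jacobson_bot a ⊤
    Module.Finite.fg_top h.ge
    ((IsLocalRing.le_maximalIdeal ha).trans (IsLocalRing.maximalIdeal_le_jacobson _))
  exact top_ne_bot h2

/-- The theorem of Rees, for the `a`-depth of a nonzero module over a Noetherian local ring. -/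
lemma natCast_le_depth_iff [IsNoetherianRing R] (ha : a ≠ ⊤) (k : ℕ) :
    (k : ℕ∞) ≤ depth a L ↔ GradeGE a k L := by
  have hne := smul_top_ne_top (L := L) ha
  have hlen : ∀ rs : List R, (∀ x ∈ rs, x ∈ a) → RingTheory.Sequence.IsRegular L rs →
      GradeGE a rs.length L := fun rs hmem hreg =>
    ModuleCat.subsingleton_ext_of_exists_isRegular a (ModuleCat.of R (R ⧸ a))
      support_quotient.subset (ModuleCat.of R L) hne.lt_top rs hmem hreg
  rw [depth, if_neg hne]
  constructor
  · intro h
    rcases Nat.eq_zero_or_pos k with rfl | hk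
    · intro i hi; omega
    have h1 : ((k - 1 : ℕ) : ℕ∞) < ⨆ rs ∈ {rs : List R | (∀ x ∈ rs, x ∈ a) ∧
        RingTheory.Sequence.IsRegular L rs}, (rs.length : ℕ∞) :=
      lt_of_lt_of_le (by exact_mod_cast Nat.sub_lt hk one_pos) h
    obtain ⟨rs, hrs⟩ := lt_iSup_iff.mp h1
    obtain ⟨⟨hmem, hreg⟩, hlt⟩ := lt_iSup_iff.mp hrs
    have : k ≤ rs.length := by
      have := Nat.cast_lt.mp hlt
      omega
    exact (hlen rs hmem hreg).mono this
  · intro h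
    obtain ⟨rs, hl, hmem, hreg⟩ := ModuleCat.exists_isRegular_of_exists_subsingleton_ext a k
      (ModuleCat.of R L) hne.lt_top (ModuleCat.of R (R ⧸ a)) support_quotient h
    rw [← hl]
    exact le_iSup₂_of_le rs ⟨hmem, hreg⟩ le_rfl

end Rees

/-! ### Syzygies -/

section Factor

variable {R : Type u} [CommRing R] {A B C : Type*} [AddCommGroup A] [Module R A]
  [AddCommGroup B] [Module R B] [AddCommGroup C] [Module R C]

lemma exists_desc {f : A →ₗ[R] B} {g : B →ₗ[R] C} (hfg : Function.Exact f g)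
    (hg : Function.Surjective g) {L : Type*} [AddCommGroup L] [Module R L] (φ : B →ₗ[R] L)
    (hφ : φ ∘ₗ f = 0) : ∃ ψ : C →ₗ[R] L, ψ ∘ₗ g = φ := by
  have hker : LinearMap.ker g ≤ LinearMap.ker φ := by
    intro x hx
    obtain ⟨y, rfl⟩ := (hfg x).mp hx
    exact LinearMap.congr_fun hφ y
  refine ⟨(LinearMap.ker g).liftQ φ hker ∘ₗ (g.quotKerEquivOfSurjective hg).symm.toLinearMap, ?_⟩
  ext x
  have : (g.quotKerEquivOfSurjective hg).symm (g x) = Submodule.Quotient.mk x := by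
    rw [LinearEquiv.symm_apply_eq]; rfl
  simp [this]

/-- If multiplication by `x` on `C` factors through a projective module, then on the kernel `A` of
a projective cover `B → C` it factors through the inclusion of `A` in `B`. -/
lemma exists_factor_syzygy {f : A →ₗ[R] B} {g : B →ₗ[R] C} (hf : Function.Injective f)
    (hfg : Function.Exact f g) (hg : Function.Surjective g) {P : Type*} [AddCommGroup P]
    [Module R P] [Module.Projective R P] {x : R} {i : C →ₗ[R] P} {j : P →ₗ[R] C}
    (hij : ∀ y, j (i y) = x • y) : ∃ ρ : B →ₗ[R] A, ∀ y, ρ (f y) = x • y := by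
  obtain ⟨j', hj'⟩ := Module.projective_lifting_property g j hg
  -- `σ` agrees with multiplication by `x` on `A`, and its values lie in the kernel of `g`
  let σ : B →ₗ[R] B := x • LinearMap.id - j' ∘ₗ i ∘ₗ g
  have hσ : ∀ y, σ y ∈ LinearMap.range f := by
    intro y
    apply (hfg _).mp
    have := LinearMap.congr_fun hj' (i (g y))
    simp only [LinearMap.comp_apply] at this
    simp [σ, this, hij]
  let e := LinearEquiv.ofInjective f hf
  refine ⟨e.symm.toLinearMap ∘ₗ σ.codRestrict _ hσ, fun y => ?_⟩
  rw [LinearMap.comp_apply, LinearEquiv.coe_coe, LinearEquiv.symm_apply_eq]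
  ext
  simp [σ, e, hfg.apply_apply_eq_zero]

end Factor

section Syzygy

variable {R : Type u} [CommRing R] [IsLocalRing R]

lemma IsFirstSyzygy.exists_exact {N K : Type u} [AddCommGroup N] [Module R N]
    [AddCommGroup K] [Module R K] (h : IsFirstSyzygy R N K) :
    ∃ (b : ℕ) (ι : K →ₗ[R] (Fin b → R)) (π : (Fin b → R) →ₗ[R] N),
      Function.Injective ι ∧ Function.Exact ι π ∧ Function.Surjective π := by
  obtain ⟨b, π, hπ, -, ⟨e⟩⟩ := h
  refine ⟨b, (LinearMap.ker π).subtype ∘ₗ e.toLinearMap, π, ?_, ?_, hπ⟩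
  · exact (Submodule.injective_subtype _).comp e.injective
  · intro x
    constructor
    · intro hx
      exact ⟨e.symm ⟨x, hx⟩, by simp⟩
    · rintro ⟨y, rfl⟩
      exact (e y).2

lemma IsSyzygy.finite [IsNoetherianRing R] {n : ℕ} {N M : Type u} [AddCommGroup N] [Module R N]
    [AddCommGroup M] [Module R M] [Module.Finite R N] (h : IsSyzygy R n N M) :
    Module.Finite R M := by
  induction n generalizing N with
  | zero => exact Module.Finite.equiv (Nonempty.some h).symm
  | succ n ih =>
    obtain ⟨K, hK, hM⟩ := h
    obtain ⟨b, ι, π, hι, -, -⟩ := hK.exists_exact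
    have : Module.Finite R K := Module.Finite.of_injective ι hι
    exact ih hM

variable {a : Ideal R}

/-- Each step of a free resolution raises the grade by one, up to the grade of `R`. -/
lemma IsSyzygy.gradeGE {r k : ℕ} {Y Z : Type u} [AddCommGroup Y] [Module R Y]
    [AddCommGroup Z] [Module R Z] (h : IsSyzygy R r Y Z) (hY : GradeGE a k Y)
    (hR : GradeGE a (r + k) R) : GradeGE a (r + k) Z := by
  induction r generalizing Y k with
  | zero =>
    rw [zero_add]
    exact hY.congr (Nonempty.some h).symm
  | succ r ih =>
    obtain ⟨K, hK, hZ⟩ := h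
    obtain ⟨b, ι, π, hι, hιπ, hπ⟩ := hK.exists_exact
    have hK : GradeGE a (k + 1) K :=
      GradeGE.kernel hι hιπ hπ hY ((hR.mono (by omega)).pi b)
    rw [show r + 1 + k = r + (k + 1) by omega] at hR ⊢
    exact ih hZ hK hR

/-- `Ext^(m+1)(K, L)` is the cokernel of `Hom(P, L) → Hom(Ω^(m+1) K, L)`, where the syzygy embeds
in the last free module `P` of the resolution. If multiplication by an element `x` on `K`
factors through a free module, then on the syzygy it factors through `P`, so that `x` kills this
cokernel. -/
lemma IsSyzygy.exists_embedding {m : ℕ} {K B : Type u} [AddCommGroup K] [Module R K]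
    [AddCommGroup B] [Module R B] (h : IsSyzygy R (m + 1) K B)
    (ha : ∀ x ∈ a, ∃ (c : ℕ) (i : K →ₗ[R] (Fin c → R)) (j : (Fin c → R) →ₗ[R] K),
      ∀ y, j (i y) = x • y) :
    ∃ (c : ℕ) (ι : B →ₗ[R] (Fin c → R)),
      (∀ (L : Type u) [AddCommGroup L] [Module R L], ExtVanish (R := R) K (m + 1) L ↔
        ∀ φ : B →ₗ[R] L, ∃ ψ : (Fin c → R) →ₗ[R] L, φ = ψ ∘ₗ ι) ∧
      ∀ x ∈ a, ∃ ρ : (Fin c → R) →ₗ[R] B, ∀ y, ρ (ι y) = x • y := by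
  induction m generalizing K with
  | zero =>
    obtain ⟨K', hK, ⟨e⟩⟩ := h
    obtain ⟨b, ι, π, hι, hιπ, hπ⟩ := hK.exists_exact
    have hinj : Function.Injective (ι ∘ₗ e.toLinearMap) := hι.comp e.injective
    have hex : Function.Exact (ι ∘ₗ e.toLinearMap) π := by
      intro x
      rw [hιπ x]
      constructor
      · rintro ⟨y, rfl⟩
        exact ⟨e.symm y, by simp⟩
      · rintro ⟨y, rfl⟩
        exact ⟨e y, rfl⟩
    refine ⟨b, ι ∘ₗ e.toLinearMap, fun L _ _ => extVanish_one_iff hinj hex hπ, fun x hx => ?_⟩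
    obtain ⟨c, i, j, hij⟩ := ha x hx
    exact exists_factor_syzygy hinj hex hπ hij
  | succ m ih =>
    obtain ⟨K', hK, hB⟩ := h
    obtain ⟨b, ι, π, hι, hιπ, hπ⟩ := hK.exists_exact
    obtain ⟨c, κ, h1, h2⟩ := ih hB (fun x hx => by
      obtain ⟨c, i, j, hij⟩ := ha x hx
      obtain ⟨ρ, hρ⟩ := exists_factor_syzygy hι hιπ hπ hij
      exact ⟨b, ι, ρ, hρ⟩)
    exact ⟨c, κ, fun L _ _ => (extVanish_shift hι hιπ hπ).trans (h1 L), h2⟩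

/-- For `K = R ⧸ a` each element of `a` acts as zero, so that `IsSyzygy.exists_embedding` applies; for
`m = 0` the free module is zero. -/
lemma IsSyzygy.exists_embedding_quotient {m : ℕ} {B : Type u}
    [AddCommGroup B] [Module R B] (h : IsSyzygy R m (R ⧸ a) B) :
    ∃ (c : ℕ) (ι : B →ₗ[R] (Fin c → R)),
      (∀ (L : Type u) [AddCommGroup L] [Module R L], ExtVanish (R := R) (R ⧸ a) m L ↔
        ∀ φ : B →ₗ[R] L, ∃ ψ : (Fin c → R) →ₗ[R] L, φ = ψ ∘ₗ ι) ∧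
      ∀ x ∈ a, ∃ ρ : (Fin c → R) →ₗ[R] B, ∀ y, ρ (ι y) = x • y := by
  have hzero : ∀ x ∈ a, ∀ y : R ⧸ a, x • y = 0 := by
    intro x hx y
    obtain ⟨y, rfl⟩ := Ideal.Quotient.mk_surjective y
    rw [← Ideal.Quotient.mk_eq_mk, ← Submodule.Quotient.mk_smul, Submodule.Quotient.mk_eq_zero]
    exact a.mul_mem_right y hx
  rcases m with _ | m
  · obtain ⟨e⟩ := h
    refine ⟨0, 0, fun L _ _ => extVanish_zero_iff.trans ⟨fun h φ => ⟨0, ?_⟩, fun h φ => ?_⟩,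
      fun x hx => ⟨0, fun y => ?_⟩⟩
    · have := h (φ ∘ₗ e.symm.toLinearMap)
      ext y
      simpa using LinearMap.congr_fun this (e y)
    · obtain ⟨ψ, hψ⟩ := h (φ ∘ₗ e.toLinearMap)
      refine LinearMap.ext fun y => ?_
      simpa using LinearMap.congr_fun hψ (e.symm y)
    · apply e.injective
      simp [hzero x hx]
  · exact h.exists_embedding fun x hx => ⟨0, 0, 0, fun y => by simp [hzero x hx]⟩

/-- Applying `Hom(-, L)` to a free resolution of `K`, the grade drops by one at each step. -/
lemma IsSyzygy.gradeGE_hom {m k : ℕ} {K B L : Type u} [AddCommGroup K] [Module R K]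
    [AddCommGroup B] [Module R B] [AddCommGroup L] [Module R L] (h : IsSyzygy R m K B)
    (hext : ∀ i < m, ExtVanish (R := R) K (i + 1) L)
    (hK : GradeGE a (k + m) (K →ₗ[R] L)) (hL : GradeGE a (k + m - 1) L) :
    GradeGE a k (B →ₗ[R] L) := by
  induction m generalizing K with
  | zero => exact hK.congr (LinearEquiv.congrLeft L R (Nonempty.some h).symm)
  | succ m ih =>
    obtain ⟨K', hK', hB⟩ := h
    obtain ⟨b, ι, π, hι, hιπ, hπ⟩ := hK'.exists_exact
    refine ih hB (fun i hi => (extVanish_shift hι hιπ hπ).mp (hext (i + 1) (by omega))) ?_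
      (hL.mono (by omega))
    refine GradeGE.cokernel (f := LinearMap.lcomp R L π) (g := LinearMap.lcomp R L ι)
      ?_ ?_ ?_ hK (hL.hom_free b)
    · intro φ ψ hφψ
      exact (LinearMap.cancel_right hπ).mp hφψ
    · intro φ
      constructor
      · intro hφ
        obtain ⟨ψ, hψ⟩ := exists_desc hιπ hπ φ hφ
        exact ⟨ψ, hψ⟩
      · rintro ⟨ψ, rfl⟩
        ext x
        simp [hιπ.apply_apply_eq_zero]
    · intro φ
      obtain ⟨ψ, hψ⟩ := (extVanish_one_iff hι hιπ hπ).mp (hext 0 (by omega)) φ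
      exact ⟨ψ, hψ.symm⟩

end Syzygy

/-! ### Tensor products and short exact sequences -/

section Tensor

open TensorProduct Function

variable {R : Type u} [CommRing R]

lemma lTensor_rTensor_apply {A B C D : Type*} [AddCommGroup A] [Module R A] [AddCommGroup B]
    [Module R B] [AddCommGroup C] [Module R C] [AddCommGroup D] [Module R D]
    (f : A →ₗ[R] B) (g : C →ₗ[R] D) (z : A ⊗[R] C) :
    g.lTensor B (f.rTensor C z) = f.rTensor D (g.lTensor A z) := by
  rw [← LinearMap.comp_apply, ← LinearMap.comp_apply, LinearMap.lTensor_comp_rTensor,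
    LinearMap.rTensor_comp_lTensor]

lemma rTensor_comp_apply_eq_zero {A B C : Type*} [AddCommGroup A] [Module R A] [AddCommGroup B]
    [Module R B] [AddCommGroup C] [Module R C] {f : A →ₗ[R] B} {g : B →ₗ[R] C}
    (h : g ∘ₗ f = 0) (L : Type*) [AddCommGroup L] [Module R L] (z : A ⊗[R] L) :
    g.rTensor L (f.rTensor L z) = 0 := by
  rw [← LinearMap.rTensor_comp_apply, h, LinearMap.rTensor_zero, LinearMap.zero_apply]

lemma lTensor_comp_apply_eq_zero {A B C : Type*} [AddCommGroup A] [Module R A] [AddCommGroup B]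
    [Module R B] [AddCommGroup C] [Module R C] {f : A →ₗ[R] B} {g : B →ₗ[R] C}
    (h : g ∘ₗ f = 0) (L : Type*) [AddCommGroup L] [Module R L] (z : L ⊗[R] A) :
    g.lTensor L (f.lTensor L z) = 0 := by
  rw [← LinearMap.lTensor_comp_apply, h, LinearMap.lTensor_zero, LinearMap.zero_apply]

section Shift

variable {L' F L : Type*} [AddCommGroup L'] [Module R L'] [AddCommGroup F] [Module R F]
  [AddCommGroup L] [Module R L] {ι : L' →ₗ[R] F} {π : F →ₗ[R] L}

/-- If `x` times each cycle of `A ⊗ L → G ⊗ L` comes from `E ⊗ L`, then `x` kills the kernel of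
`T ⊗ L' → T ⊗ F`, where `T = coker (A → G)` and `0 → L' → F → L → 0` is exact. For `F` flat this
kernel is `Tor₁(T, L)`. -/
lemma smul_eq_zero_of_cycles {E A G T : Type*} [AddCommGroup E] [Module R E] [AddCommGroup A]
    [Module R A] [AddCommGroup G] [Module R G] [AddCommGroup T] [Module R T] [Module.Flat R G]
    (hι : Injective ι) (hιπ : Exact ι π) (hπ : Surjective π)
    {e : E →ₗ[R] A} {d : A →ₗ[R] G} {τ : G →ₗ[R] T} (hed : d ∘ₗ e = 0) (hdτ : Exact d τ)
    (hτ : Surjective τ) {x : R}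
    (hx : ∀ z : A ⊗[R] L, d.rTensor L z = 0 → ∃ v, e.rTensor L v = x • z)
    {z : T ⊗[R] L'} (hz : ι.lTensor T z = 0) : x • z = 0 := by
  obtain ⟨y, rfl⟩ := LinearMap.rTensor_surjective L' hτ z
  rw [lTensor_rTensor_apply] at hz
  obtain ⟨w, hw⟩ := (rTensor_exact F hdτ hτ _).mp hz
  have hcyc : d.rTensor L (π.lTensor A w) = 0 := by
    rw [← lTensor_rTensor_apply, hw, lTensor_comp_apply_eq_zero hιπ.linearMap_comp_eq_zero]
  obtain ⟨v, hv⟩ := hx _ hcyc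
  obtain ⟨v, rfl⟩ := LinearMap.lTensor_surjective E hπ v
  obtain ⟨t, ht⟩ := (lTensor_exact A hιπ hπ (x • w - e.rTensor F v)).mp (by
    rw [map_sub, map_smul, lTensor_rTensor_apply, hv, sub_self])
  have h1 : d.rTensor L' t = x • y := by
    apply Module.Flat.lTensor_preserves_injective_linearMap (M := G) ι hι
    rw [lTensor_rTensor_apply, ht, map_sub, map_smul, hw, rTensor_comp_apply_eq_zero hed, sub_zero,
      map_smul]
  rw [← map_smul, ← h1, rTensor_comp_apply_eq_zero hdτ.linearMap_comp_eq_zero]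

variable {C₃ C₂ C₁ C₀ : Type*} [AddCommGroup C₃] [Module R C₃] [AddCommGroup C₂] [Module R C₂]
  [AddCommGroup C₁] [Module R C₁] [AddCommGroup C₀] [Module R C₀]
  {d₃ : C₃ →ₗ[R] C₂} {d₂ : C₂ →ₗ[R] C₁} {d₁ : C₁ →ₗ[R] C₀}

/-- One half of the dimension shift for the homology of `- ⊗ C` along `0 → L' → F → L → 0`. -/
lemma exact_lTensor_of_shift [Module.Flat R F]
    (hιπ : Exact ι π) (hπ : Surjective π)
    (h₃₂ : Exact d₃ d₂) (h₂₁ : d₁ ∘ₗ d₂ = 0) (hinj : Injective (ι.rTensor C₀))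
    (hex : Exact (d₂.lTensor L') (d₁.lTensor L')) :
    Exact (d₃.lTensor L) (d₂.lTensor L) := by
  intro z
  constructor
  · intro hz
    obtain ⟨y, rfl⟩ := LinearMap.rTensor_surjective C₂ hπ z
    rw [lTensor_rTensor_apply] at hz
    obtain ⟨t, ht⟩ := (rTensor_exact C₁ hιπ hπ _).mp hz
    obtain ⟨s, rfl⟩ := (hex t).mp (hinj (by
      rw [← lTensor_rTensor_apply, ht, lTensor_comp_apply_eq_zero h₂₁, map_zero]))
    obtain ⟨w, hw⟩ := (Module.Flat.lTensor_exact F h₃₂ (y - ι.rTensor C₂ s)).mp (by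
      rw [map_sub, lTensor_rTensor_apply, ht, sub_self])
    refine ⟨π.rTensor C₃ w, ?_⟩
    rw [lTensor_rTensor_apply, hw, map_sub, rTensor_comp_apply_eq_zero hιπ.linearMap_comp_eq_zero,
      sub_zero]
  · rintro ⟨y, rfl⟩
    exact lTensor_comp_apply_eq_zero h₃₂.linearMap_comp_eq_zero L y

/-- The other half of the dimension shift: boundaries in `F ⊗ C` that lie in `L' ⊗ C` are
boundaries there. -/
lemma exists_boundary_of_shift [Module.Flat R C₁]
    (hι : Injective ι) (hιπ : Exact ι π) (hπ : Surjective π) (h₃₂ : d₂ ∘ₗ d₃ = 0)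
    (hex : Exact (d₃.lTensor L) (d₂.lTensor L)) {t : L' ⊗[R] C₁} {y : F ⊗[R] C₂}
    (hy : d₂.lTensor F y = ι.rTensor C₁ t) : ∃ s, d₂.lTensor L' s = t := by
  obtain ⟨w, hw⟩ := (hex (π.rTensor C₂ y)).mp (by
    rw [lTensor_rTensor_apply, hy, rTensor_comp_apply_eq_zero hιπ.linearMap_comp_eq_zero])
  obtain ⟨w, rfl⟩ := LinearMap.rTensor_surjective C₃ hπ w
  obtain ⟨s, hs⟩ := (rTensor_exact C₂ hιπ hπ (y - d₃.lTensor F w)).mp (by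
    rw [map_sub, ← hw, lTensor_rTensor_apply, sub_self])
  refine ⟨s, ?_⟩
  apply Module.Flat.rTensor_preserves_injective_linearMap (M := C₁) ι hι
  rw [← lTensor_rTensor_apply, hs, map_sub, hy, lTensor_comp_apply_eq_zero h₃₂, sub_zero]

end Shift

/-! ### Tensoring the dual of a free presentation -/

section Dual

lemma dualTensorHom_rTensor_dualMap {F F' L : Type*} [AddCommGroup F] [Module R F]
    [AddCommGroup F'] [Module R F'] [AddCommGroup L] [Module R L] (f : F' →ₗ[R] F)
    (z : Module.Dual R F ⊗[R] L) :
    dualTensorHom R F' L (f.dualMap.rTensor L z) = dualTensorHom R F L z ∘ₗ f := by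
  induction z with
  | zero => ext; simp
  | tmul a b => ext; simp
  | add a b ha hb => simp only [map_add, ha, hb, LinearMap.add_comp]

lemma dualTensorHomEquiv_apply {F L : Type*} [AddCommGroup F] [Module R F]
    [Module.Finite R F] [Module.Projective R F] [AddCommGroup L] [Module R L]
    (z : Module.Dual R F ⊗[R] L) : dualTensorHomEquiv R F L z = dualTensorHom R F L z := rfl

/-- A cycle of `F₀* ⊗ L → F₁* ⊗ L` is a homomorphism from `B = coker (F₁ → F₀)` to `L`. If the multiples
by `x` of such homomorphisms factor through `ι : B → P`, then the multiples of the cycles by `x` come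
from `P* ⊗ L`. -/
lemma exists_rTensor_dualMap_eq_smul {F₁ F₀ B P L : Type*} [AddCommGroup F₁] [Module R F₁]
    [AddCommGroup F₀] [Module R F₀] [Module.Projective R F₀]
    [Module.Finite R F₀] [AddCommGroup B] [Module R B] [AddCommGroup P] [Module R P]
    [Module.Projective R P] [Module.Finite R P] [AddCommGroup L] [Module R L]
    {f : F₁ →ₗ[R] F₀} {g : F₀ →ₗ[R] B} (hfg : Exact f g) (hg : Surjective g)
    {ι : B →ₗ[R] P} {x : R} (hx : ∀ φ : B →ₗ[R] L, ∃ ψ : P →ₗ[R] L, x • φ = ψ ∘ₗ ι)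
    (z : Module.Dual R F₀ ⊗[R] L) (hz : f.dualMap.rTensor L z = 0) :
    ∃ v, (ι ∘ₗ g).dualMap.rTensor L v = x • z := by
  obtain ⟨φ, hφ⟩ := exists_desc hfg hg (dualTensorHom R F₀ L z) (by
    rw [← dualTensorHom_rTensor_dualMap, hz, map_zero])
  obtain ⟨ψ, hψ⟩ := hx φ
  obtain ⟨v, hv⟩ := (dualTensorHomEquiv R P L).surjective ψ
  rw [dualTensorHomEquiv_apply] at hv
  refine ⟨v, (dualTensorHomEquiv R F₀ L).injective ?_⟩
  simp only [dualTensorHomEquiv_apply]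
  rw [dualTensorHom_rTensor_dualMap, hv, map_smul, ← hφ, ← LinearMap.comp_assoc, ← hψ,
    LinearMap.smul_comp]

end Dual

/-! ### Second Tor over a local ring -/

section Local

variable [IsLocalRing R]

/-- Over a local ring, `C ⊗ M = 0` for finitely generated modules only if `C = 0` or `M = 0`; this is
applied to the cokernel of `e`. -/
lemma surjective_of_rTensor_surjective {E W M : Type u} [AddCommGroup E] [Module R E]
    [AddCommGroup W] [Module R W] [Module.Finite R W] [AddCommGroup M] [Module R M]
    [Module.Finite R M] [Nontrivial M] {e : E →ₗ[R] W} (h : Surjective (e.rTensor M)) :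
    Surjective e := by
  let C := W ⧸ LinearMap.range e
  let k := IsLocalRing.ResidueField R
  have h1 : Subsingleton (C ⊗[R] M) := by
    have key : ∀ z : C ⊗[R] M, z = 0 := fun z => by
      obtain ⟨y, rfl⟩ := LinearMap.rTensor_surjective M (LinearMap.range e).mkQ_surjective z
      obtain ⟨x, rfl⟩ := h y
      exact rTensor_comp_apply_eq_zero (LinearMap.range_mkQ_comp e) M x
    exact ⟨fun x y => (key x).trans (key y).symm⟩
  have h2 : Subsingleton ((k ⊗[R] C) ⊗[k] (k ⊗[R] M)) :=
    (TensorProduct.AlgebraTensorModule.distribBaseChange R k C M).symm.toEquiv.subsingleton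
  have h3 : Nontrivial (k ⊗[R] M) := by
    rw [← not_subsingleton_iff_nontrivial, IsLocalRing.subsingleton_tensorProduct]
    exact not_subsingleton M
  have h4 : Subsingleton (k ⊗[R] C) := by
    by_contra hn
    have := not_subsingleton_iff_nontrivial.mp hn
    exact not_subsingleton ((k ⊗[R] C) ⊗[k] (k ⊗[R] M)) h2
  have h5 : Subsingleton C := IsLocalRing.subsingleton_tensorProduct.mp h4
  rw [← LinearMap.range_eq_top]
  exact Submodule.Quotient.subsingleton_iff.mp h5

/-- `Tor₂(T, M) = 0` and the exactness of `E ⊗ M → A ⊗ M → G ⊗ M` force `E → A → G` to be exact,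
if `T` is the cokernel of `A → G`. The vanishing of `Tor₂(T, M)` is expressed by short exact
sequences `0 → M' → F → M → 0` and `0 → M'' → F' → M' → 0`. -/
lemma exact_of_exact_rTensor {E A G T M M' M'' F F' : Type u} [AddCommGroup E] [Module R E]
    [AddCommGroup A] [Module R A] [IsNoetherian R A] [AddCommGroup G] [Module R G]
    [Module.Flat R G]
    [AddCommGroup T] [Module R T] [AddCommGroup M] [Module R M] [Module.Finite R M]
    [Nontrivial M] [AddCommGroup M'] [Module R M'] [AddCommGroup M''] [Module R M'']
    [AddCommGroup F] [Module R F] [Module.Flat R F] [AddCommGroup F'] [Module R F']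
    [Module.Flat R F'] {ι : M' →ₗ[R] F} {π : F →ₗ[R] M} (hι : Injective ι) (hιπ : Exact ι π)
    (hπ : Surjective π) {ι' : M'' →ₗ[R] F'} {π' : F' →ₗ[R] M'}
    (hιπ' : Exact ι' π') (hπ' : Surjective π') {e : E →ₗ[R] A} {d : A →ₗ[R] G} {τ : G →ₗ[R] T}
    (hed : d ∘ₗ e = 0) (hdτ : Exact d τ) (hτ : Surjective τ)
    (hex : Exact (e.rTensor M) (d.rTensor M)) (hinj : Injective (ι'.rTensor T)) :
    Exact e d := by
  let I := LinearMap.range d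
  let W := LinearMap.ker d
  have hIG : Exact I.subtype τ := fun x => by
    rw [hdτ x]
    exact ⟨fun h => ⟨⟨x, h⟩, rfl⟩, fun ⟨y, hy⟩ => hy ▸ y.2⟩
  have h1 : Injective (I.subtype.lTensor M') :=
    lTensor_injective_of_exact_of_exact_of_rTensor_injective hιπ' hπ' hIG hτ hinj
      (Module.Flat.lTensor_preserves_injective_linearMap _ I.injective_subtype)
  have h2 : Injective (ι.rTensor I) := by
    intro x y hxy
    apply h1
    apply Module.Flat.rTensor_preserves_injective_linearMap (M := G) ι hι
    rw [← lTensor_rTensor_apply, ← lTensor_rTensor_apply, hxy]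
  have hWA : Exact W.subtype d.rangeRestrict := fun x => by
    rw [← Subtype.coe_inj]
    exact ⟨fun h => ⟨⟨x, h⟩, rfl⟩, fun ⟨y, hy⟩ => hy ▸ y.2⟩
  have h3 : Injective (W.subtype.lTensor M) :=
    lTensor_injective_of_exact_of_exact_of_rTensor_injective hιπ hπ hWA d.surjective_rangeRestrict
      h2 (Module.Flat.lTensor_preserves_injective_linearMap _ W.injective_subtype)
  have h3' : Injective (W.subtype.rTensor M) :=
    (LinearMap.lTensor_inj_iff_rTensor_inj M W.subtype).mp h3
  let e' : E →ₗ[R] W := e.codRestrict W (fun x => LinearMap.congr_fun hed x)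
  have he' : W.subtype ∘ₗ e' = e := rfl
  have hsurj : Surjective (e'.rTensor M) := by
    intro w
    obtain ⟨v, hv⟩ := (hex (W.subtype.rTensor M w)).mp
      (rTensor_comp_apply_eq_zero (LinearMap.comp_ker_subtype d) M w)
    refine ⟨v, h3' ?_⟩
    rw [← LinearMap.rTensor_comp_apply, he', hv]
  intro x
  constructor
  · intro hx
    obtain ⟨v, hv⟩ := surjective_of_rTensor_surjective hsurj ⟨x, hx⟩
    exact ⟨v, congrArg Subtype.val hv⟩
  · rintro ⟨y, rfl⟩
    exact LinearMap.congr_fun hed y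

end Local

end Tensor

/-! ### Computing Tor by a resolution of the second argument -/

section Tor

open TensorProduct Limits

/-- A projective resolution of `T`, as a sequence of linear maps. It computes `Tor`. -/
lemma exists_resolution_tor {R : Type u} [CommRing R] (T : ModuleCat.{u} R) :
    ∃ (P : ℕ → ModuleCat.{u} R) (d : ∀ i, P (i + 1) →ₗ[R] P i) (ε : P 0 →ₗ[R] T),
      (∀ i, Module.Flat R (P i)) ∧ (∀ i, Function.Exact (d (i + 1)) (d i)) ∧
      Function.Exact (d 0) ε ∧ Function.Surjective ε ∧
      ∀ (L : Type u) [AddCommGroup L] [Module R L] (i : ℕ),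
        IsZero (((Tor (ModuleCat.{u} R) (i + 1)).obj (ModuleCat.of R L)).obj T) ↔
          Function.Exact ((d (i + 1)).lTensor L) ((d i).lTensor L) := by
  obtain ⟨Q⟩ := (inferInstance : HasProjectiveResolution T).out
  refine ⟨Q.complex.X, fun i => (Q.complex.d (i + 1) i).hom, (Q.π.f 0).hom, fun i => ?_,
    fun i => ?_, ?_, ?_, fun L _ _ i => ?_⟩
  · have : Module.Projective R (Q.complex.X i) :=
      (IsProjective.iff_projective _).mpr (Q.projective i)
    infer_instance
  · exact (ShortComplex.ShortExact.moduleCat_exact_iff_function_exact _).mp (Q.exact_succ i)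
  · exact (ShortComplex.ShortExact.moduleCat_exact_iff_function_exact _).mp Q.exact₀
  · exact (ModuleCat.epi_iff_surjective _).mp (inferInstance : Epi (Q.π.f 0))
  · let Fn := (MonoidalCategory.tensoringLeft (ModuleCat.{u} R)).obj (ModuleCat.of R L)
    have h1 := (Q.isoLeftDerivedObj Fn (i + 1)).isZero_iff
    refine h1.trans ?_
    refine (HomologicalComplex.exactAt_iff_isZero_homology _ _).symm.trans ?_
    refine (HomologicalComplex.exactAt_iff' _ (i + 2) (i + 1) i (by simp) (by simp)).trans ?_
    exact ShortComplex.ShortExact.moduleCat_exact_iff_function_exact _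

end Tor

open TensorProduct Function

/-! ### Descent of Tor vanishing from a syzygy

Below, `d` and `ε` form a flat resolution `⋯ → P 1 → P 0 → T`, and the vanishing of
`Torᵢ₊₁(L, T)` is expressed by the exactness of `L ⊗ P (i + 2) → L ⊗ P (i + 1) → L ⊗ P i`. -/

section Descent

variable {R : Type u} [CommRing R]

/-- The grade of the last term of an exact sequence `0 → H → A → G → T → 0`. -/
lemma GradeGE.of_four_term {a : Ideal R} {k : ℕ} {H A G T : Type u} [AddCommGroup H]
    [Module R H] [AddCommGroup A] [Module R A] [AddCommGroup G] [Module R G] [AddCommGroup T]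
    [Module R T] {s : H →ₗ[R] A} {d : A →ₗ[R] G} {τ : G →ₗ[R] T} (hs : Injective s)
    (hsd : Exact s d) (hdτ : Exact d τ) (hτ : Surjective τ) (hH : GradeGE a (k + 2) H)
    (hA : GradeGE a (k + 1) A) (hG : GradeGE a k G) : GradeGE a k T := by
  have h1 : Exact s d.rangeRestrict := fun x => by
    rw [← hsd x, ← Subtype.coe_inj]; rfl
  have h2 : GradeGE a (k + 1) (LinearMap.range d) :=
    GradeGE.cokernel hs h1 d.surjective_rangeRestrict hH hA
  refine GradeGE.cokernel (LinearMap.range d).injective_subtype (fun x => ?_) hτ h2 hG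
  rw [hdτ x]
  exact ⟨fun h => ⟨⟨x, h⟩, rfl⟩, fun ⟨y, hy⟩ => hy ▸ y.2⟩

/-- The dual `F₀* → F₁* → T → 0` of the presentation `F₁ → F₀ → B → 0`, tensored with `L`, extends to
the exact sequence `0 → Hom(B, L) → F₀* ⊗ L → F₁* ⊗ L → T ⊗ L → 0`. -/
lemma GradeGE.tensor_of_hom {a : Ideal R} {k p q : ℕ} {B T L : Type u} [AddCommGroup B]
    [Module R B] [AddCommGroup T] [Module R T] [AddCommGroup L] [Module R L]
    {f : (Fin p → R) →ₗ[R] (Fin q → R)} {g : (Fin q → R) →ₗ[R] B} (hfg : Exact f g)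
    (hg : Surjective g) {τ : Module.Dual R (Fin p → R) →ₗ[R] T} (hfτ : Exact f.dualMap τ)
    (hτ : Surjective τ) (hB : GradeGE a (k + 2) (B →ₗ[R] L)) (hL : GradeGE a (k + 1) L) :
    GradeGE a k (T ⊗[R] L) := by
  let θ := dualTensorHomEquiv R (Fin q → R) L
  have hθ : ∀ (φ : (Fin q → R) →ₗ[R] L), f.dualMap.rTensor L (θ.symm φ) = 0 ↔ φ ∘ₗ f = 0 := by
    intro φ
    obtain ⟨z, rfl⟩ := θ.surjective φ
    rw [θ.symm_apply_apply, dualTensorHomEquiv_apply, ← dualTensorHom_rTensor_dualMap,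
      ← dualTensorHomEquiv_apply, LinearEquiv.map_eq_zero_iff]
  have hG : GradeGE a k (Module.Dual R (Fin p → R) ⊗[R] L) :=
    GradeGE.congr (dualTensorHomEquiv R (Fin p → R) L).symm ((hL.mono (by omega)).hom_free p)
  have hA : GradeGE a (k + 1) (Module.Dual R (Fin q → R) ⊗[R] L) :=
    GradeGE.congr θ.symm (hL.hom_free q)
  refine GradeGE.of_four_term (s := θ.symm.toLinearMap ∘ₗ LinearMap.lcomp R L g)
    (d := f.dualMap.rTensor L) (τ := τ.rTensor L) ?_ ?_ (rTensor_exact L hfτ hτ)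
    (LinearMap.rTensor_surjective L hτ) hB hA hG
  · exact θ.symm.injective.comp fun φ ψ h => (LinearMap.cancel_right hg).mp h
  · intro z
    obtain ⟨φ, rfl⟩ := θ.symm.surjective z
    rw [hθ]
    constructor
    · intro h
      obtain ⟨ψ, hψ⟩ := exists_desc hfg hg φ h
      exact ⟨ψ, congrArg θ.symm hψ⟩
    · rintro ⟨ψ, hψ⟩
      have : ψ ∘ₗ g = φ := θ.symm.injective hψ
      rw [← this, LinearMap.comp_assoc, hfg.linearMap_comp_eq_zero, LinearMap.comp_zero]

/-- Exactness of a sequence `L ⊗ C₂ → L ⊗ C₁ → L ⊗ C₀` only depends on `L` up to isomorphism. -/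
lemma exact_lTensor_congr {C₂ C₁ C₀ L L' : Type*} [AddCommGroup C₂] [Module R C₂]
    [AddCommGroup C₁] [Module R C₁] [AddCommGroup C₀] [Module R C₀] [AddCommGroup L] [Module R L]
    [AddCommGroup L'] [Module R L'] {d₂ : C₂ →ₗ[R] C₁} {d₁ : C₁ →ₗ[R] C₀} (e : L ≃ₗ[R] L')
    (h : Exact (d₂.lTensor L) (d₁.lTensor L)) : Exact (d₂.lTensor L') (d₁.lTensor L') :=
  (Exact.iff_of_ladder_linearEquiv (e₁ := e.rTensor C₂) (e₂ := e.rTensor C₁)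
    (e₃ := e.rTensor C₀) (LinearMap.ext fun z => lTensor_rTensor_apply _ _ z)
    (LinearMap.ext fun z => lTensor_rTensor_apply _ _ z)).mpr h

variable {T : Type u} [AddCommGroup T] [Module R T] {P : ℕ → ModuleCat.{u} R}
  {d : ∀ i, P (i + 1) →ₗ[R] P i} {ε : P 0 →ₗ[R] T}

variable {L' F L : Type u} [AddCommGroup L'] [Module R L'] [AddCommGroup F] [Module R F]
  [AddCommGroup L] [Module R L] {ι : L' →ₗ[R] F} {π : F →ₗ[R] L}

/-- `Torᵢ₊₁(L', T) = 0` implies `Torᵢ₊₂(L, T) = 0`. -/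
lemma exact_lTensor_succ [Module.Flat R F] [∀ i, Module.Flat R (P i)]
    (hd : ∀ i, Exact (d (i + 1)) (d i))
    (hι : Injective ι) (hιπ : Exact ι π) (hπ : Surjective π) {i : ℕ}
    (h : Exact ((d (i + 1)).lTensor L') ((d i).lTensor L')) :
    Exact ((d (i + 2)).lTensor L) ((d (i + 1)).lTensor L) :=
  exact_lTensor_of_shift hιπ hπ (hd (i + 1)) (hd i).linearMap_comp_eq_zero
    (Module.Flat.rTensor_preserves_injective_linearMap ι hι) h

/-- `Tor₁(L, T) = 0` if `T ⊗ L' → T ⊗ F` is injective. -/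
lemma exact_lTensor_one [Module.Flat R F] (hd : ∀ i, Exact (d (i + 1)) (d i)) (hε : Exact (d 0) ε)
    (hεs : Surjective ε) (hιπ : Exact ι π) (hπ : Surjective π)
    (h : Injective (ι.lTensor T)) :
    Exact ((d 1).lTensor L) ((d 0).lTensor L) :=
  exact_lTensor_of_shift hιπ hπ (hd 0) hε.linearMap_comp_eq_zero
    ((LinearMap.lTensor_inj_iff_rTensor_inj T ι).mp h) (lTensor_exact L' hε hεs)

/-- `Torᵢ₊₂(L, T) = 0` implies `Torᵢ₊₁(L', T) = 0`. -/
lemma exact_lTensor_of_succ [Module.Flat R F] [∀ i, Module.Flat R (P i)]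
    (hd : ∀ i, Exact (d (i + 1)) (d i))
    (hι : Injective ι) (hιπ : Exact ι π) (hπ : Surjective π) {i : ℕ}
    (h : Exact ((d (i + 2)).lTensor L) ((d (i + 1)).lTensor L)) :
    Exact ((d (i + 1)).lTensor L') ((d i).lTensor L') := by
  intro t
  constructor
  · intro ht
    obtain ⟨y, hy⟩ := (Module.Flat.lTensor_exact F (hd i) (ι.rTensor _ t)).mp (by
      rw [lTensor_rTensor_apply, ht, map_zero])
    exact exists_boundary_of_shift hι hιπ hπ (hd (i + 1)).linearMap_comp_eq_zero h hy
  · rintro ⟨s, rfl⟩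
    exact lTensor_comp_apply_eq_zero (hd i).linearMap_comp_eq_zero _ s

/-- `Tor₁(L, T) = 0` makes `L' ⊗ T → F ⊗ T` injective. -/
lemma injective_rTensor_of_exact_lTensor [∀ i, Module.Flat R (P i)]
    (hd : ∀ i, Exact (d (i + 1)) (d i))
    (hε : Exact (d 0) ε) (hεs : Surjective ε)
    (hι : Injective ι) (hιπ : Exact ι π) (hπ : Surjective π)
    (h : Exact ((d 1).lTensor L) ((d 0).lTensor L)) : Injective (ι.rTensor T) := by
  rw [injective_iff_map_eq_zero]
  intro z hz
  obtain ⟨t, rfl⟩ := LinearMap.lTensor_surjective L' hεs z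
  rw [← lTensor_rTensor_apply] at hz
  obtain ⟨y, hy⟩ := (lTensor_exact F hε hεs _).mp hz
  obtain ⟨s, rfl⟩ := exists_boundary_of_shift hι hιπ hπ (hd 0).linearMap_comp_eq_zero h hy
  exact lTensor_comp_apply_eq_zero hε.linearMap_comp_eq_zero _ s

variable [IsLocalRing R] [∀ i, Module.Flat R (P i)]

/-- `Torᵢ₊ₙ(N, T) = 0` implies `Torᵢ(Ωⁿ N, T) = 0` for `i ≥ 1`. -/
lemma IsSyzygy.exact_lTensor (hd : ∀ i, Exact (d (i + 1)) (d i)) {n i : ℕ} {N M : Type u}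
    [AddCommGroup N] [Module R N] [AddCommGroup M] [Module R M] (h : IsSyzygy R n N M)
    (hN : Exact ((d (i + n + 1)).lTensor N) ((d (i + n)).lTensor N)) :
    Exact ((d (i + 1)).lTensor M) ((d i).lTensor M) := by
  induction n generalizing N with
  | zero =>
    obtain ⟨e⟩ := h
    exact exact_lTensor_congr e.symm hN
  | succ n ih =>
    obtain ⟨K, hK, hM⟩ := h
    obtain ⟨b, ι, π, hι, hιπ, hπ⟩ := hK.exists_exact
    exact ih hM (exact_lTensor_of_succ (i := i + n) hd hι hιπ hπ hN)

/-- Suppose that all `Tor₁(L, T)` are killed by `a`, that `Tor₁(Ωⁿ N, T) = 0`, and that `T ⊗ Ωⁿ N` has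
grade at least `n`, and `T` at least `n - 1`. Then `Torᵢ(N, T) = 0` for `1 ≤ i ≤ n + 1`: while the
grade of `T ⊗ Ωʲ⁺¹ N` is positive, its submodule `Tor₁(Ωʲ N, T)` vanishes, so that
`0 → T ⊗ Ωʲ⁺¹ N → T ⊗ F → T ⊗ Ωʲ N → 0` is exact and the grade drops by at most one. The parameter `k`
is there for the induction. -/
lemma IsSyzygy.exact_lTensor_of_grade (hd : ∀ i, Exact (d (i + 1)) (d i)) (hε : Exact (d 0) ε)
    (hεs : Surjective ε) {a : Ideal R}
    (htor : ∀ {L' F L : Type u} [AddCommGroup L'] [Module R L'] [AddCommGroup F] [Module R F]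
      [AddCommGroup L] [Module R L] {ι : L' →ₗ[R] F} {π : F →ₗ[R] L}, Injective ι →
      Exact ι π → Surjective π → ∀ z : T ⊗[R] L', ι.lTensor T z = 0 → ∀ x ∈ a, x • z = 0)
    {n k : ℕ} {N M : Type u}
    [AddCommGroup N] [Module R N] [AddCommGroup M] [Module R M] (h : IsSyzygy R n N M)
    (hM : Exact ((d 1).lTensor M) ((d 0).lTensor M))
    (hTM : GradeGE a (n + k) (T ⊗[R] M)) (hT : GradeGE a (n + k - 1) T) :
    GradeGE a k (T ⊗[R] N) ∧ ∀ i ≤ n, Exact ((d (i + 1)).lTensor N) ((d i).lTensor N) := by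
  induction n generalizing N k with
  | zero =>
    obtain ⟨e⟩ := h
    refine ⟨(hTM.mono (by omega)).congr (e.lTensor T), fun i hi => ?_⟩
    obtain rfl : i = 0 := by omega
    exact exact_lTensor_congr e hM
  | succ n ih =>
    obtain ⟨K, hK, hKM⟩ := h
    obtain ⟨b, ι, π, hι, hιπ, hπ⟩ := hK.exists_exact
    obtain ⟨hg, hex⟩ := ih (k := k + 1) hKM (hTM.mono (by omega)) (hT.mono (by omega))
    have hinj : Injective (ι.lTensor T) := by
      rw [injective_iff_map_eq_zero]
      exact fun z hz => hg.eq_zero (by omega) (htor hι hιπ hπ z hz)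
    refine ⟨GradeGE.cokernel hinj (lTensor_exact T hιπ hπ) (LinearMap.lTensor_surjective T hπ)
      hg ((hT.mono (by omega)).tensor_free b), fun i hi => ?_⟩
    rcases i with _ | i
    · exact exact_lTensor_one hd hε hεs hιπ hπ hinj
    · exact exact_lTensor_succ hd hι hιπ hπ (hex i (by omega))

end Descent

/-! ### The depth inequality -/

section Main

variable {R : Type u} [CommRing R] [IsLocalRing R]

/-- Lifting a basis of `N / 𝔪 N` to `N` gives a minimal free cover. -/
lemma exists_minimal_free_cover (N : Type u) [AddCommGroup N] [Module R N] [Module.Finite R N] :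
    ∃ (b : ℕ) (π : (Fin b → R) →ₗ[R] N), Surjective π ∧
      LinearMap.ker π ≤ IsLocalRing.maximalIdeal R • (⊤ : Submodule R (Fin b → R)) := by
  let k := IsLocalRing.ResidueField R
  let β := Module.finBasis k (k ⊗[R] N)
  have hmk : Surjective (TensorProduct.mk R k N 1) :=
    TensorProduct.mk_surjective R N k Ideal.Quotient.mk_surjective
  choose v hv using fun i => hmk (β i)
  refine ⟨_, Fintype.linearCombination R v, ?_, fun w hw => ?_⟩
  · rw [← LinearMap.range_eq_top, Fintype.range_linearCombination]
    exact IsLocalRing.span_eq_top_of_tmul_eq_basis v β hv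
  · have hsum : ∑ i, IsLocalRing.residue R (w i) • β i = 0 := by
      have h1 := congrArg (TensorProduct.mk R k N 1) (LinearMap.mem_ker.mp hw)
      rw [Fintype.linearCombination_apply, map_sum, map_zero] at h1
      rw [← h1]
      refine Finset.sum_congr rfl fun i _ => ?_
      rw [map_smul, hv i]
      exact (algebraMap_smul k (w i) (β i))
    have hw' : ∀ i, w i ∈ IsLocalRing.maximalIdeal R := fun i =>
      (IsLocalRing.residue_eq_zero_iff _).mp
        (Fintype.linearIndependent_iff.mp β.linearIndependent _ hsum i)
    rw [pi_eq_sum_univ' w]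
    exact Submodule.sum_mem _ fun i _ => Submodule.smul_mem_smul (hw' i) trivial

lemma IsSyzygyModule.gradeGE {a : Ideal R} {r : ℕ} {X : Type u} [AddCommGroup X] [Module R X]
    (h : IsSyzygyModule R r X) (hR : GradeGE a r R) : GradeGE a r X := by
  obtain ⟨Y, Z, -, hZ, p, q, ⟨e⟩⟩ := h
  have hZ' : GradeGE a r Z := hZ.gradeGE (k := 0) (fun i hi => absurd hi (by omega)) hR
  have hsum : GradeGE a r (Z × (Fin q → R)) :=
    GradeGE.middle (f := LinearMap.inl R Z (Fin q → R)) (g := LinearMap.snd R Z (Fin q → R))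
      LinearMap.inl_injective .inl_snd LinearMap.snd_surjective hZ' (hR.pi q)
  exact hsum.of_retract (s := e.toLinearMap ∘ₗ LinearMap.inl R X (Fin p → R))
    (r := LinearMap.fst R X (Fin p → R) ∘ₗ e.symm.toLinearMap) (by ext; simp)

variable [IsNoetherianRing R]

lemma exists_isSyzygy (m : ℕ) (N : Type u) [AddCommGroup N] [Module R N] [Module.Finite R N] :
    ∃ B : ModuleCat.{u} R, IsSyzygy R m N B := by
  induction m generalizing N with
  | zero => exact ⟨ModuleCat.of R N, ⟨LinearEquiv.refl R N⟩⟩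
  | succ m ih =>
    obtain ⟨b, π, hπ, hker⟩ := exists_minimal_free_cover (R := R) N
    obtain ⟨B, hB⟩ := ih (LinearMap.ker π)
    exact ⟨B, ModuleCat.of R (LinearMap.ker π), ⟨b, π, hπ, hker, ⟨LinearEquiv.refl R _⟩⟩, hB⟩

lemma exists_isTranspose (X : Type u) [AddCommGroup X] [Module R X] [Module.Finite R X] :
    ∃ T : ModuleCat.{u} R, IsTranspose R X T := by
  obtain ⟨q, g, hg, hgker⟩ := exists_minimal_free_cover (R := R) X
  obtain ⟨p, π, hπ, hker⟩ := exists_minimal_free_cover (R := R) (LinearMap.ker g)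
  have hrange : LinearMap.range ((LinearMap.ker g).subtype ∘ₗ π) = LinearMap.ker g := by
    rw [LinearMap.range_comp, LinearMap.range_eq_top.mpr hπ, Submodule.map_top,
      Submodule.range_subtype]
  refine ⟨ModuleCat.of R (Module.Dual R (Fin p → R) ⧸
    LinearMap.range ((LinearMap.ker g).subtype ∘ₗ π).dualMap), p, q,
    (LinearMap.ker g).subtype ∘ₗ π, g, hg, LinearMap.exact_iff.mpr hrange.symm,
    hrange.le.trans hgker, ?_, ⟨LinearEquiv.refl R _⟩⟩
  rwa [LinearMap.ker_comp_of_ker_eq_bot _ (Submodule.ker_subtype _)]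

/-- If the grade of `a` on `M = Ωⁿ N` exceeds `m + n`, then the grade of `a` on `R` exceeds `m`. Here
`T` is the transpose of `B = Ωᵐ (R ⧸ a)`. -/
theorem gradeGE_succ_of_torRigid {a : Ideal R} {m n : ℕ} {N M B T : Type u} [AddCommGroup N]
    [Module R N] [Module.Finite R N] [AddCommGroup M] [Module R M] [Nontrivial M]
    [AddCommGroup B] [Module R B] [AddCommGroup T] [Module R T]
    (hM : IsSyzygy R n N M) (hrigid : IsTorRigid R (n + 1) N) (hB : IsSyzygy R m (R ⧸ a) B)
    (hBT : IsTranspose R B T) (hT : GradeGE a (n - 1) T) (hR : GradeGE a m R)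
    (hMg : GradeGE a (m + n + 1) M) : GradeGE a (m + 1) R := by
  have : Module.Finite R M := hM.finite
  obtain ⟨p, q, f, g, hg, hfg, -, -, ⟨eT⟩⟩ := hBT
  let τ : Module.Dual R (Fin p → R) →ₗ[R] T :=
    eT.symm.toLinearMap ∘ₗ (LinearMap.range f.dualMap).mkQ
  have hτ : Surjective τ := eT.symm.surjective.comp (Submodule.mkQ_surjective _)
  have hfτ : Exact f.dualMap τ := by
    rw [LinearMap.exact_iff, LinearEquiv.ker_comp, Submodule.ker_mkQ]
  have : Module.Finite R T := Module.Finite.of_surjective τ hτ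
  obtain ⟨c, ι, hι, hιa⟩ := hB.exists_embedding_quotient
  have hed : f.dualMap ∘ₗ (ι ∘ₗ g).dualMap = 0 :=
    LinearMap.ext fun φ => LinearMap.ext fun y => by simp [hfg.apply_apply_eq_zero]
  have hιM := (hι M).mp (hMg m (by omega))
  -- the resolution of `R ⧸ a` dualizes into `M` to an exact complex with `m + 2` terms of grade at
  -- least `m + n + 1`, which ends in `T ⊗ M`
  have hTM : GradeGE a n (T ⊗[R] M) := by
    refine GradeGE.tensor_of_hom hfg hg hfτ hτ (hB.gradeGE_hom
      (fun i hi => hMg (i + 1) (by omega)) ?_ (hMg.mono (by omega))) (hMg.mono (by omega))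
    exact GradeGE.of_eq_zero (extVanish_zero_iff.mp (hMg 0 (by omega))) _
  have htor : ∀ {L' F L : Type u} [AddCommGroup L'] [Module R L'] [AddCommGroup F] [Module R F]
      [AddCommGroup L] [Module R L] {ι : L' →ₗ[R] F} {π : F →ₗ[R] L}, Injective ι →
      Exact ι π → Surjective π → ∀ z : T ⊗[R] L', ι.lTensor T z = 0 → ∀ x ∈ a, x • z = 0 := by
    intro L' F L _ _ _ _ _ _ i π hi hiπ hπ z hz x hx
    obtain ⟨ρ, hρ⟩ := hιa x hx
    refine smul_eq_zero_of_cycles hi hiπ hπ hed hfτ hτ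
      (exists_rTensor_dualMap_eq_smul hfg hg fun φ => ⟨φ ∘ₗ ρ, ?_⟩) hz
    ext y
    simp [hρ]
  have hcycM := exists_rTensor_dualMap_eq_smul (x := 1) (L := M) hfg hg (ι := ι)
    (by simpa using hιM)
  obtain ⟨P, d, ε, hP, hd, hε, hεs, hTor⟩ := exists_resolution_tor (ModuleCat.of R T)
  obtain ⟨b, π, hπ, -⟩ := exists_minimal_free_cover (R := R) M
  obtain ⟨b', π', hπ', -⟩ := exists_minimal_free_cover (R := R) (LinearMap.ker π)
  -- the cycles in question are boundaries, since `Extᵐ(R ⧸ a, M) = 0`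
  have hTor₁ : Exact ((d 1).lTensor M) ((d 0).lTensor M) := by
    refine exact_lTensor_one hd hε hεs π.exact_subtype_ker_map hπ ?_
    rw [injective_iff_map_eq_zero]
    intro z hz
    simpa using smul_eq_zero_of_cycles (x := 1) (LinearMap.ker π).injective_subtype
      π.exact_subtype_ker_map hπ hed hfτ hτ hcycM hz
  have hvan := (hM.exact_lTensor_of_grade (k := 0) hd hε hεs htor hTor₁ hTM hT).2
  -- `n + 1` consecutive modules vanish, starting with the first one
  have hall := hrigid (ModuleCat.of R T) 0 (fun i hi hi' => by
    obtain ⟨j, rfl⟩ : ∃ j, i = j + 1 := ⟨i - 1, by omega⟩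
    exact (hTor N j).mpr (hvan j (by omega)))
  have hTor₂ : Exact ((d 2).lTensor M) ((d 1).lTensor M) :=
    hM.exact_lTensor hd ((hTor N (1 + n)).mp (hall _ (by omega)))
  have hTor₁' := exact_lTensor_of_succ (i := 0) hd (LinearMap.ker π).injective_subtype
    π.exact_subtype_ker_map hπ hTor₂
  have hinj := injective_rTensor_of_exact_lTensor hd hε hεs (LinearMap.ker π').injective_subtype
    π'.exact_subtype_ker_map hπ' hTor₁'
  -- exactness here means that `Extᵐ(R ⧸ a, M) = 0`
  have hexM : Exact ((ι ∘ₗ g).dualMap.rTensor M) (f.dualMap.rTensor M) := fun z =>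
    ⟨fun hz => by simpa using hcycM z hz, by
      rintro ⟨v, rfl⟩
      exact rTensor_comp_apply_eq_zero hed M v⟩
  -- and exactness here means that `Extᵐ(R ⧸ a, R) = 0`
  have hex : Exact (ι ∘ₗ g).dualMap f.dualMap :=
    exact_of_exact_rTensor (LinearMap.ker π).injective_subtype π.exact_subtype_ker_map hπ
      π'.exact_subtype_ker_map hπ' hed hfτ hτ hexM hinj
  intro i hi
  rcases Nat.lt_succ_iff_lt_or_eq.mp hi with hi | rfl
  · exact hR i hi
  · refine (hι R).mpr fun φ => ?_
    obtain ⟨ψ, hψ⟩ := (hex (φ ∘ₗ g)).mp (by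
      change (φ ∘ₗ g) ∘ₗ f = 0
      rw [LinearMap.comp_assoc, hfg.linearMap_comp_eq_zero, LinearMap.comp_zero])
    exact ⟨ψ, ((LinearMap.cancel_right hg).mp hψ).symm⟩

end Main

end DepthIneq

theorem theorem3p3 (R : Type u) [CommRing R] [IsLocalRing R] [IsNoetherianRing R]
    (N : Type u) [AddCommGroup N] [Module R N] [Module.Finite R N]
    (a : Ideal R) (n : ℕ)
    (M : Type u) [AddCommGroup M] [Module R M]
    (hM : DepthIneq.IsSyzygy R n N M)
    (hM0 : Nontrivial M)
    (hmn : (n : ℕ∞) ≤ DepthIneq.depth a R)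
    (hrigid : DepthIneq.IsTorRigid R (n + 1) N)
    (hfree : 1 ≤ n → DepthIneq.IsLocallyFreeOn N (DepthIneq.depthLocus R (n - 1)))
    (htr : 1 ≤ n → ∀ m : ℕ, DepthIneq.depth a R = m →
      ∃ B T : ModuleCat.{u} R, DepthIneq.IsSyzygy R m (R ⧸ a) B ∧
        DepthIneq.IsTranspose R B T ∧ DepthIneq.IsSyzygyModule R (n - 1) T) :
    DepthIneq.depth a M ≤ DepthIneq.depth a R + n := by
  have : Module.Finite R M := hM.finite
  by_cases hfin : DepthIneq.depth a R = ⊤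
  · simp [hfin]
  obtain ⟨m, hm⟩ := ENat.ne_top_iff_exists.mp hfin
  have ha : a ≠ ⊤ := by
    rintro rfl
    exact hfin (if_pos (by simp))
  have hR : DepthIneq.GradeGE a m R := (DepthIneq.natCast_le_depth_iff ha m).mp hm.le
  have hnm : n ≤ m := by
    rw [← hm] at hmn
    exact_mod_cast hmn
  obtain ⟨B, T, hB, hBT, hT⟩ : ∃ B T : ModuleCat.{u} R, DepthIneq.IsSyzygy R m (R ⧸ a) B ∧
      DepthIneq.IsTranspose R B T ∧ DepthIneq.GradeGE a (n - 1) T := by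
    rcases Nat.eq_zero_or_pos n with rfl | hn
    -- for `n = 0` any transpose will do, the bound `n - 1` on its grade being void
    · obtain ⟨B, hB⟩ := DepthIneq.exists_isSyzygy (R := R) m (R ⧸ a)
      have : Module.Finite R B := hB.finite
      obtain ⟨T, hT⟩ := DepthIneq.exists_isTranspose (R := R) B
      exact ⟨B, T, hB, hT, fun i hi => absurd hi (by omega)⟩
    · obtain ⟨B, T, hB, hBT, hT⟩ := htr hn m hm.symm
      exact ⟨B, T, hB, hBT, hT.gradeGE (hR.mono (by omega))⟩
  by_contra! hlt
  have hMg : DepthIneq.GradeGE a (m + n + 1) M := by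
    rw [← DepthIneq.natCast_le_depth_iff ha]
    rw [← hm] at hlt
    exact_mod_cast Order.add_one_le_of_lt hlt
  have h1 := (DepthIneq.natCast_le_depth_iff ha (m + 1)).mpr
    (DepthIneq.gradeGE_succ_of_torRigid hM hrigid hB hBT hT hR hMg)
  rw [← hm] at h1
  have := Nat.cast_le.mp h1
  omega
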